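/- Let $d\in\mathbb N$. For $\varphi\in\mathscr S(\mathbb R^d)$ and $f\in\mathscr S'(\mathbb R^d)$ let $$V_\varphi f(x,\eta)=(f,M_\eta T_x\varphi)=\langle f,\overline{M_\eta T_x\varphi}\rangle,\qquad x,\eta\in\mathbb R^d,$$ be the short-time Fourier transform, where $T_x\varphi(y)=\varphi(y-x)$, $M_\eta\varphi(y)=e^{2\pi i\, y\cdot\eta}\varphi(y)$, and $\langle\cdot,\cdot\rangle$ is the linear action of tempered distributions on Schwartz functions. Write $\langle (x,\eta)\rangle=(1+|x|^2+|\eta|^2)^{1/2}$. For $B>0$ say that $V_\varphi f$ decays rapidly in the cone $|\eta|>B|x|$ if $$\sup_{|\eta|>B|x|}\langle (x,\eta)\rangle^n\,|V_\varphi f(x,\eta)|<\infty\qquad\text{for all integers } n>0,$$ and let $V_{\rm con}^\varphi(\mathbb R^d)$ be the linear space of all $f\in\mathscr S'(\mathbb R^d)$ for which $V_\varphi f$ decays rapidly in the cone $|\eta|>B|x|$ for some $B>0$. **Lemma.** Let $\varphi,\psi\in\mathscr S(\mathbb R^d)\setminus\{0\}$. Then $V_{\rm con}^\varphi(\mathbb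 R^d)=V_{\rm con}^\psi(\mathbb R^d)$. More precisely, if $f\in\mathscr S'(\mathbb R^d)$, $B>0$ and $V_\varphi f$ decays rapidly in the cone $|\eta|>B|x|$, then for every $B'>B$ the function $V_\psi f$ decays rapidly in the cone $|\eta|>B'|x|$. -/

import Mathlib

open scoped SchwartzMap

noncomputable section

/-- The space `ℝ^d` with its Euclidean norm and inner product. -/
abbrev Rd (d : ℕ) := EuclideanSpace ℝ (Fin d)

/-- The character `x ↦ e^{2π i ⟨x, ξ⟩}`. -/
def character {d : ℕ} (ξ : Rd d) (x : Rd d) : ℂ :=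
  Complex.exp (((2 * Real.pi * inner ℝ x ξ : ℝ) : ℂ) * Complex.I)

lemma character_hasTemperateGrowth {d : ℕ} (ξ : Rd d) :
    (character ξ).HasTemperateGrowth := by
  have hexp : (fun t : ℝ ↦ Complex.exp ((t : ℂ) * Complex.I)).HasTemperateGrowth := by
    have hderiv (n : ℕ) : iteratedDeriv n (fun t : ℝ ↦ Complex.exp ((t : ℂ) * Complex.I)) =
        fun t : ℝ ↦ Complex.I ^ n * Complex.exp ((t : ℂ) * Complex.I) := by
      induction n with
      | zero => simp
      | succ n ih =>
        rw [iteratedDeriv_succ, ih]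
        ext t
        have h := (((hasDerivAt_id t).ofReal_comp.mul_const Complex.I).cexp).const_mul
          (Complex.I ^ n)
        refine h.deriv.trans ?_
        simp only [id, Complex.ofReal_one]
        ring
    refine ⟨?_, fun n ↦ ⟨0, 1, fun t ↦ ?_⟩⟩
    · exact (Complex.ofRealCLM.contDiff.mul contDiff_const).cexp
    · rw [norm_iteratedFDeriv_eq_norm_iteratedDeriv, hderiv n]
      simp [Complex.norm_exp_ofReal_mul_I]
  refine hexp.comp (g := fun t : ℝ ↦ Complex.exp ((t : ℂ) * Complex.I))
    (f := fun x : Rd d ↦ 2 * Real.pi * inner ℝ x ξ) ?_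
  exact (Function.HasTemperateGrowth.const (2 * Real.pi)).mul
    (Function.hasTemperateGrowth_inner_left ξ)

/-- Translation `(T_t φ)(x) = φ (x - t)`. -/
def translation {d : ℕ} (t : Rd d) (φ : 𝓢(Rd d, ℂ)) : 𝓢(Rd d, ℂ) :=
  SchwartzMap.compSubConstCLM ℂ t φ

/-- Modulation `(M_ξ φ)(x) = e^{2π i ⟨x, ξ⟩} φ x`; see `modulation_apply`. -/
def modulation {d : ℕ} (ξ : Rd d) (φ : 𝓢(Rd d, ℂ)) : 𝓢(Rd d, ℂ) :=
  SchwartzMap.smulLeftCLM ℂ (character ξ) φ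

lemma translation_apply {d : ℕ} (t : Rd d) (φ : 𝓢(Rd d, ℂ)) (x : Rd d) :
    translation t φ x = φ (x - t) := rfl

lemma modulation_apply {d : ℕ} (ξ : Rd d) (φ : 𝓢(Rd d, ℂ)) (x : Rd d) :
    modulation ξ φ x = character ξ x * φ x := by
  rw [modulation, SchwartzMap.smulLeftCLM_apply_apply (character_hasTemperateGrowth ξ),
    smul_eq_mul]

/-- The complex conjugate of a Schwartz function. -/
def conjugate {d : ℕ} (φ : 𝓢(Rd d, ℂ)) : 𝓢(Rd d, ℂ) :=
  SchwartzMap.postcompCLM (𝕜 := ℝ) (Complex.conjCLE : ℂ →L[ℝ] ℂ) φ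

lemma conjugate_apply {d : ℕ} (φ : 𝓢(Rd d, ℂ)) (x : Rd d) :
    conjugate φ x = starRingEnd ℂ (φ x) := rfl

/-- The short-time Fourier transform `V_φ f (x, η) = (f, M_η T_x φ)` of a tempered distribution,
where `(u, χ) = ⟨u, conj χ⟩` is conjugate linear in the test function. -/
def stft {d : ℕ} (φ : 𝓢(Rd d, ℂ)) (f : 𝓢'(Rd d, ℂ)) (x η : Rd d) : ℂ :=
  f (conjugate (modulation η (translation x φ)))

/-- The bracket `⟨(x, η)⟩ = (1 + |(x, η)|²)^{1/2}` on `ℝ^d × ℝ^d = ℝ^{2d}`, with the Euclidean norm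
of `ℝ^{2d}`, i.e. `|(x, η)|² = |x|² + |η|²`. -/
def bracket {d : ℕ} (x η : Rd d) : ℝ :=
  Real.sqrt (1 + (‖x‖ ^ 2 + ‖η‖ ^ 2))

/-- `sup_{|η| > B|x|} ⟨(x, η)⟩^n |V_φ f (x, η)| < ∞` for all `n > 0`. -/
def RapidDecayInCone {d : ℕ} (φ : 𝓢(Rd d, ℂ)) (B : ℝ) (f : 𝓢'(Rd d, ℂ)) : Prop :=
  ∀ n : ℕ, 0 < n → ∃ C : ℝ, ∀ x η : Rd d, B * ‖x‖ < ‖η‖ →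
    bracket x η ^ n * ‖stft φ f x η‖ ≤ C

lemma RapidDecayInCone.mono {d : ℕ} {φ : 𝓢(Rd d, ℂ)} {B B' : ℝ} {f : 𝓢'(Rd d, ℂ)}
    (h : RapidDecayInCone φ B f) (hB : B ≤ B') : RapidDecayInCone φ B' f := by
  intro n hn
  obtain ⟨C, hC⟩ := h n hn
  exact ⟨C, fun x η hx ↦ hC x η
    ((mul_le_mul_of_nonneg_right hB (norm_nonneg x)).trans_lt hx)⟩

/-- The linear space `V_con^φ(ℝ^d)` of tempered distributions `f` such that `V_φ f` decays rapidly
in some cone `|η| > B |x|`, `B > 0`. -/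
def Vcon {d : ℕ} (φ : 𝓢(Rd d, ℂ)) : Submodule ℂ (𝓢'(Rd d, ℂ)) where
  carrier := {f | ∃ B : ℝ, 0 < B ∧ RapidDecayInCone φ B f}
  zero_mem' := ⟨1, one_pos, fun n _ ↦ ⟨0, fun x η _ ↦ by simp [stft]⟩⟩
  add_mem' := by
    rintro f g ⟨B₁, hB₁, h₁⟩ ⟨B₂, hB₂, h₂⟩
    refine ⟨max B₁ B₂, lt_max_of_lt_left hB₁, fun n hn ↦ ?_⟩
    obtain ⟨C₁, hC₁⟩ := h₁.mono (le_max_left B₁ B₂) n hn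
    obtain ⟨C₂, hC₂⟩ := h₂.mono (le_max_right B₁ B₂) n hn
    refine ⟨C₁ + C₂, fun x η hx ↦ ?_⟩
    have hb : 0 ≤ bracket x η ^ n := pow_nonneg (Real.sqrt_nonneg _) n
    calc bracket x η ^ n * ‖stft φ (f + g) x η‖
        ≤ bracket x η ^ n * (‖stft φ f x η‖ + ‖stft φ g x η‖) :=
          mul_le_mul_of_nonneg_left (norm_add_le _ _) hb
      _ ≤ C₁ + C₂ := by
          rw [mul_add]
          exact add_le_add (hC₁ x η hx) (hC₂ x η hx)
  smul_mem' := by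
    rintro c f ⟨B, hB, h⟩
    refine ⟨B, hB, fun n hn ↦ ?_⟩
    obtain ⟨C, hC⟩ := h n hn
    refine ⟨‖c‖ * C, fun x η hx ↦ ?_⟩
    have hs : stft φ (c • f) x η = c * stft φ f x η := rfl
    rw [hs, norm_mul, mul_left_comm]
    exact mul_le_mul_of_nonneg_left (hC x η hx) (norm_nonneg c)

end

/-! Put g = conj(M_η T_x ψ). Inversion of the short-time Fourier transform with window φ writes
‖φ‖₂² g as a superposition of the functions conj(M_ξ T_y φ) with coefficients c(y, ξ) (`stftCoeff`).
Applying f gives ‖φ‖₂² V_ψ f(x, η) = ∫ c(y, ξ) V_φ f(y, ξ) dy dξ (`stft_change_window`). The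
analytic point is moving f under the integral (`map_eq_integral`): by Hahn–Banach, f factors through
a Banach space, where Bochner integration applies.

The coefficients decay faster than any power of W = (1+|x-y|)(1+|η-ξ|) (`exists_stftCoeff_le`). So
it suffices to bound w^n |V_φ f(y, ξ)|, with w = (1+|x|)(1+|η|), by a power of W whenever |η| >
B'|x| (`RapidDecayInCone.exists_le_weight_sub`). If |ξ| > B|y|, this is the hypothesis together with
w ≤ (1+|y|)(1+|ξ|)W. Otherwise V_φ f grows at most polynomially, and the gap between B and B' forces
w ≤ K W² (`exists_weight_le_of_cone`). -/

noncomputable section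

open MeasureTheory BoundedContinuousFunction

/-! ### Exchanging a tempered distribution with an integral of Schwartz functions. -/

namespace SchwartzMap

variable {D : Type*} [NormedAddCommGroup D] [NormedSpace ℝ D]

/-- The space of bounded continuous multilinear-map-valued functions. -/
abbrev BoundedMultilinearField (D : Type*) [NormedAddCommGroup D] [NormedSpace ℝ D] (n : ℕ) :=
  @BoundedContinuousFunction D (D [×n]→L[ℝ] ℂ) _
    (NormedAddCommGroup.toSeminormedAddCommGroup (E := D [×n]→L[ℝ] ℂ)).toPseudoMetricSpace

/-- The bounded continuous function `x ↦ ‖x‖ ^ k • D^n g x`. -/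
def weightedDerivCLM (k n : ℕ) : 𝓢(D, ℂ) →L[ℂ] BoundedMultilinearField D n :=
  mkCLMtoNormedSpace (D := D) (E := ℂ) (G := BoundedMultilinearField D n) (𝕜 := ℂ) (𝕜' := ℂ) (σ := RingHom.id ℂ)
    (fun g ↦ BoundedContinuousFunction.ofNormedAddCommGroup
      (fun x ↦ ‖x‖ ^ k • iteratedFDeriv ℝ n g x)
      ((continuous_norm.pow k).smul ((g.smooth n).continuous_iteratedFDeriv le_rfl))
      (SchwartzMap.seminorm ℂ k n g)
      (fun x ↦ by
        rw [norm_smul, norm_pow, norm_norm]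
        exact le_seminorm ℂ k n g x))
    (fun f g ↦ by
      ext1 x
      have : iteratedFDeriv ℝ n (⇑(f + g)) x = iteratedFDeriv ℝ n f x + iteratedFDeriv ℝ n g x :=
        iteratedFDeriv_add_apply (f.smooth n).contDiffAt (g.smooth n).contDiffAt
      change ‖x‖ ^ k • iteratedFDeriv ℝ n (⇑(f + g)) x =
        ‖x‖ ^ k • iteratedFDeriv ℝ n f x + ‖x‖ ^ k • iteratedFDeriv ℝ n g x
      rw [this, smul_add])
    (fun a f ↦ by
      ext1 x
      have : iteratedFDeriv ℝ n (⇑(a • f)) x = a • iteratedFDeriv ℝ n f x :=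
        iteratedFDeriv_const_smul_apply (f.smooth n).contDiffAt
      change ‖x‖ ^ k • iteratedFDeriv ℝ n (⇑(a • f)) x =
        a • ‖x‖ ^ k • iteratedFDeriv ℝ n f x
      rw [this, smul_comm])
    ⟨{(k, n)}, 1, zero_le_one, fun f ↦ by
      rw [one_mul, Finset.sup_singleton]
      exact BoundedContinuousFunction.norm_ofNormedAddCommGroup_le _ (apply_nonneg _ _) _⟩

lemma weightedDerivCLM_apply (k n : ℕ) (g : 𝓢(D, ℂ)) (x : D) :
    weightedDerivCLM k n g x = ‖x‖ ^ k • iteratedFDeriv ℝ n g x := rfl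

lemma seminorm_le_norm_weightedDerivCLM (k n : ℕ) (g : 𝓢(D, ℂ)) :
    SchwartzMap.seminorm ℂ k n g ≤ ‖weightedDerivCLM k n g‖ := by
  refine seminorm_le_bound ℂ k n g (norm_nonneg _) fun x ↦ ?_
  have h := (weightedDerivCLM k n g).norm_coe_le_norm x
  rwa [weightedDerivCLM_apply, norm_smul, norm_pow, norm_norm] at h

lemma norm_weightedDerivCLM_le (k n : ℕ) (g : 𝓢(D, ℂ)) :
    ‖weightedDerivCLM k n g‖ ≤ SchwartzMap.seminorm ℂ k n g := by
  refine (BoundedContinuousFunction.norm_le (apply_nonneg _ _)).2 fun x ↦ ?_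
  rw [weightedDerivCLM_apply, norm_smul, norm_pow, norm_norm]
  exact le_seminorm ℂ k n g x

/-- The product of finitely many of the maps `weightedDerivCLM`. -/
def weightedDerivsCLM (s : Finset (ℕ × ℕ)) :
    𝓢(D, ℂ) →L[ℂ] ((i : s) → BoundedMultilinearField D i.1.2) :=
  ContinuousLinearMap.pi fun i ↦ weightedDerivCLM i.1.1 i.1.2

lemma sup_seminorm_le_norm_weightedDerivsCLM (s : Finset (ℕ × ℕ)) (g : 𝓢(D, ℂ)) :
    s.sup (schwartzSeminormFamily ℂ D ℂ) g ≤ ‖weightedDerivsCLM s g‖ := by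
  refine Seminorm.finset_sup_apply_le (norm_nonneg _) fun i hi ↦ ?_
  exact (seminorm_le_norm_weightedDerivCLM i.1 i.2 g).trans
    (norm_le_pi_norm (weightedDerivsCLM s g) ⟨i, hi⟩)

/-- A continuous functional on the Schwartz space factors through finitely many weighted
derivatives. -/
lemma exists_weightedDerivsCLM_factor (f : 𝓢(D, ℂ) →L[ℂ] ℂ) :
    ∃ (s : Finset (ℕ × ℕ)) (l : ((i : s) → BoundedMultilinearField D i.1.2) →L[ℂ] ℂ),
      ∀ g, f g = l (weightedDerivsCLM s g) := by
  obtain ⟨s₀, C, -, hC⟩ := Seminorm.bound_of_continuous (schwartz_withSeminorms ℂ D ℂ)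
    ((normSeminorm ℂ ℂ).comp f.toLinearMap) (continuous_norm.comp f.continuous)
  -- The index (0, 0) contributes the sup norm, which makes the map into the product injective.
  set s := insert (0, 0) s₀
  have hinj : Function.Injective (weightedDerivsCLM (D := D) s) := by
    rw [injective_iff_map_eq_zero]
    intro g hg
    ext x
    have h := norm_le_seminorm ℂ g x
    have h2 := sup_seminorm_le_norm_weightedDerivsCLM s g
    have h3 : SchwartzMap.seminorm ℂ 0 0 g ≤ s.sup (schwartzSeminormFamily ℂ D ℂ) g :=
      Seminorm.le_def.1 (Finset.le_sup (f := schwartzSeminormFamily ℂ D ℂ)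
        (Finset.mem_insert_self (0, 0) s₀)) g
    rw [hg, norm_zero] at h2
    simpa using h.trans (h3.trans h2)
  let e := LinearEquiv.ofInjective (weightedDerivsCLM (D := D) s).toLinearMap hinj
  -- The functional transported to the range is bounded for the product norm; Hahn–Banach then
  -- extends it to the whole product.
  let l₀ : StrongDual ℂ (LinearMap.range (weightedDerivsCLM (D := D) s).toLinearMap) :=
    LinearMap.mkContinuous (f.toLinearMap ∘ₗ e.symm.toLinearMap) C (fun v ↦ by
      obtain ⟨g, rfl⟩ := e.surjective v
      have h1 : ‖f g‖ ≤ C * s₀.sup (schwartzSeminormFamily ℂ D ℂ) g := hC g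
      have h2 : s₀.sup (schwartzSeminormFamily ℂ D ℂ) g ≤ ‖weightedDerivsCLM s g‖ :=
        (Seminorm.le_def.1 (Finset.sup_mono (Finset.subset_insert _ _)) g).trans
          (sup_seminorm_le_norm_weightedDerivsCLM s g)
      have h3 : ‖e g‖ = ‖weightedDerivsCLM s g‖ := rfl
      rw [h3]
      simpa using h1.trans (mul_le_mul_of_nonneg_left h2 C.2))
  obtain ⟨l, hl, -⟩ := exists_extension_norm_eq _ l₀
  refine ⟨s, l, fun g ↦ ?_⟩
  have h := hl (e g)
  have h' : l₀ (e g) = f g := by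
    change f (e.symm (e g)) = f g
    rw [e.symm_apply_apply]
  rw [← h', ← h]
  rfl

variable {Ω : Type*} [TopologicalSpace Ω] [SecondCountableTopology Ω] [MeasurableSpace Ω]
  [OpensMeasurableSpace Ω] {μ : Measure Ω}

lemma integrable_weightedDerivCLM {G : Ω → 𝓢(D, ℂ)} (hG : Continuous G) {k n : ℕ}
    (hint : Integrable (fun ω ↦ SchwartzMap.seminorm ℂ k n (G ω)) μ) :
    Integrable (fun ω ↦ weightedDerivCLM k n (G ω)) μ :=
  hint.mono' ((weightedDerivCLM k n).continuous.comp hG).aestronglyMeasurable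
    (.of_forall fun ω ↦ norm_weightedDerivCLM_le k n (G ω))

lemma integrable_iteratedFDeriv {G : Ω → 𝓢(D, ℂ)} (hG : Continuous G) {n : ℕ}
    (hint : Integrable (fun ω ↦ SchwartzMap.seminorm ℂ 0 n (G ω)) μ) (x : D) :
    Integrable (fun ω ↦ iteratedFDeriv ℝ n (G ω) x) μ := by
  have h := (BoundedContinuousFunction.evalCLM ℂ x).integrable_comp
    (integrable_weightedDerivCLM hG hint)
  simpa [weightedDerivCLM_apply] using h

/-- Differentiation under the integral, with the derivative stored through an isometry `e`. This
allows e to be the currying that relates the (n+1)-st iterated derivative to the derivative of the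
n-th. -/
lemma _root_.hasFDerivAt_integral_of_linearIsometryEquiv {Ω : Type*} [MeasurableSpace Ω]
    {μ : Measure Ω} {D F F' : Type*} [NormedAddCommGroup D] [NormedSpace ℝ D]
    [NormedAddCommGroup F] [NormedSpace ℝ F] [NormedAddCommGroup F'] [NormedSpace ℝ F']
    (e : F' ≃ₗᵢ[ℝ] (D →L[ℝ] F)) {u : Ω → D → F} {u' : Ω → D → F'} {bound : Ω → ℝ}
    (hu : ∀ y, Integrable (fun ω ↦ u ω y) μ) (hu' : ∀ y, Integrable (fun ω ↦ u' ω y) μ)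
    (hbound : ∀ ω y, ‖u' ω y‖ ≤ bound ω) (hint : Integrable bound μ)
    (hd : ∀ ω y, HasFDerivAt (u ω) (e (u' ω y)) y) (x : D) :
    HasFDerivAt (fun y ↦ ∫ ω, u ω y ∂μ) (e (∫ ω, u' ω x ∂μ)) x := by
  have h := hasFDerivAt_integral_of_dominated_of_fderiv_le (s := Set.univ) (x₀ := x)
    (F := fun y ω ↦ u ω y) (F' := fun y ω ↦ e (u' ω y)) (bound := bound) Filter.univ_mem
    (.of_forall fun y ↦ (hu y).aestronglyMeasurable) (hu x)
    (e.continuous.comp_aestronglyMeasurable (hu' x).aestronglyMeasurable)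
    (.of_forall fun ω y _ ↦ by simpa using hbound ω y) hint
    (.of_forall fun ω y _ ↦ hd ω y)
  have h2 := e.toContinuousLinearEquiv.integral_comp_comm (μ := μ) (fun ω ↦ u' ω x)
  exact h2 ▸ h

/-- Induction on n: the seminorm of index (0, n+1) dominates the next derivative uniformly in the
point. -/
lemma iteratedFDeriv_eq_integral {G : Ω → 𝓢(D, ℂ)} (hG : Continuous G)
    (hint : ∀ n, Integrable (fun ω ↦ SchwartzMap.seminorm ℂ 0 n (G ω)) μ)
    {g : 𝓢(D, ℂ)} (hg : ∀ t, ∫ ω, G ω t ∂μ = g t) (n : ℕ) (x : D) :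
    iteratedFDeriv ℝ n g x = ∫ ω, iteratedFDeriv ℝ n (G ω) x ∂μ := by
  induction n generalizing x with
  | zero =>
    simp only [iteratedFDeriv_zero_eq_comp, Function.comp_apply]
    rw [← hg x]
    exact ((continuousMultilinearCurryFin0 ℝ D ℂ).symm.toContinuousLinearEquiv.integral_comp_comm
      (μ := μ) (fun ω ↦ G ω x)).symm
  | succ n ih =>
    have hd := hasFDerivAt_integral_of_linearIsometryEquiv (μ := μ)
      (continuousMultilinearCurryLeftEquiv ℝ (fun _ : Fin (n + 1) ↦ D) ℂ)
      (u := fun ω ↦ iteratedFDeriv ℝ n (G ω)) (u' := fun ω ↦ iteratedFDeriv ℝ (n + 1) (G ω))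
      (integrable_iteratedFDeriv hG (hint n)) (integrable_iteratedFDeriv hG (hint (n + 1)))
      (fun ω y ↦ norm_iteratedFDeriv_le_seminorm ℂ (G ω) (n + 1) y) (hint (n + 1))
      (fun ω y ↦ (((G ω).smooth (n + 1 : ℕ)).differentiable_iteratedFDeriv
          (by exact_mod_cast n.lt_succ_self) y).hasFDerivAt) x
    have hfun : iteratedFDeriv ℝ n g = fun y ↦ ∫ ω, iteratedFDeriv ℝ n (G ω) y ∂μ := funext ih
    rw [iteratedFDeriv_succ_eq_comp_left, Function.comp_apply, hfun, hd.fderiv]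
    exact LinearIsometryEquiv.symm_apply_apply _ _

/-- A continuous functional on the Schwartz space commutes with absolutely convergent integrals of
Schwartz functions. -/
theorem map_eq_integral {G : Ω → 𝓢(D, ℂ)} (hG : Continuous G)
    (hint : ∀ k n, Integrable (fun ω ↦ SchwartzMap.seminorm ℂ k n (G ω)) μ)
    {g : 𝓢(D, ℂ)} (hg : ∀ t, ∫ ω, G ω t ∂μ = g t) (f : 𝓢(D, ℂ) →L[ℂ] ℂ) :
    f g = ∫ ω, f (G ω) ∂μ := by
  obtain ⟨s, l, hl⟩ := exists_weightedDerivsCLM_factor f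
  have hI : Integrable (fun ω ↦ weightedDerivsCLM s (G ω)) μ :=
    Integrable.of_eval fun i ↦ integrable_weightedDerivCLM hG (hint _ _)
  -- Coordinate projections and point evaluations are continuous linear, so the Bochner integral can
  -- be identified pointwise.
  have key : weightedDerivsCLM s g = ∫ ω, weightedDerivsCLM s (G ω) ∂μ := by
    funext i
    have h1 := (ContinuousLinearMap.proj (R := ℂ)
      (φ := fun i : s ↦ BoundedMultilinearField D i.1.2) i).integral_comp_comm hI
    refine Eq.trans ?_ h1
    ext1 x
    have h2 := (BoundedContinuousFunction.evalCLM ℂ x).integral_comp_comm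
      (integrable_weightedDerivCLM hG (hint i.1.1 i.1.2))
    refine Eq.trans ?_ h2
    change ‖x‖ ^ i.1.1 • iteratedFDeriv ℝ i.1.2 g x =
      ∫ ω, ‖x‖ ^ i.1.1 • iteratedFDeriv ℝ i.1.2 (G ω) x ∂μ
    rw [integral_smul, iteratedFDeriv_eq_integral hG (hint 0) hg]
  simp only [hl]
  rw [l.integral_comp_comm hI, key]

end SchwartzMap
end

/-! ### Continuity and polynomial growth of time-frequency shifts. -/

noncomputable section

open MeasureTheory Filter Topology FourierTransform

namespace SchwartzMap

variable {d : ℕ}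

lemma continuous_finset_sup_seminorm (s : Finset (ℕ × ℕ)) :
    Continuous (s.sup (schwartzSeminormFamily ℂ (Rd d) ℂ) : Seminorm ℂ 𝓢(Rd d, ℂ)) := by
  induction s using Finset.induction_on with
  | empty => exact continuous_const (y := (0 : ℝ))
  | insert i s _ ih =>
    rw [Finset.sup_insert, Seminorm.coe_sup]
    exact ((schwartz_withSeminorms ℂ (Rd d) ℂ).continuous_seminorm i).sup ih

lemma pow_norm_mul_le_of_norm_sub_le {k n N : ℕ} (hn : n ≤ N) {K : ℕ} (hk : k ≤ K)
    (h : 𝓢(Rd d, ℂ)) {x z : Rd d} {R : ℝ} (hz : ‖z - x‖ ≤ R) :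
    ‖x‖ ^ k * ‖iteratedFDeriv ℝ n h z‖ ≤
      (1 + R) ^ k * (2 ^ K * (Finset.Iic (K, N)).sup (schwartzSeminormFamily ℂ (Rd d) ℂ) h) := by
  have hR : 0 ≤ R := (norm_nonneg _).trans hz
  have hx : ‖x‖ ≤ (1 + R) * (1 + ‖z‖) := by
    have h1 : ‖x‖ ≤ ‖z‖ + ‖z - x‖ := by
      simpa using norm_sub_le z (z - x)
    nlinarith [norm_nonneg z, mul_nonneg hR (norm_nonneg z)]
  calc ‖x‖ ^ k * ‖iteratedFDeriv ℝ n h z‖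
      ≤ ((1 + R) * (1 + ‖z‖)) ^ k * ‖iteratedFDeriv ℝ n h z‖ := by gcongr
    _ = (1 + R) ^ k * ((1 + ‖z‖) ^ k * ‖iteratedFDeriv ℝ n h z‖) := by rw [mul_pow, mul_assoc]
    _ ≤ _ := by
      refine mul_le_mul_of_nonneg_left ?_ (by positivity)
      exact one_add_le_sup_seminorm_apply (𝕜 := ℂ) (m := (K, N)) hk hn h z

lemma iteratedFDeriv_translation (n : ℕ) (y : Rd d) (h : 𝓢(Rd d, ℂ)) (x : Rd d) :
    iteratedFDeriv ℝ n (translation y h) x = iteratedFDeriv ℝ n h (x - y) :=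
  iteratedFDeriv_comp_sub (f := h) n y x

/-- Translation grows at most polynomially with respect to every continuous seminorm. -/
lemma exists_seminorm_translation_le (q : Seminorm ℂ 𝓢(Rd d, ℂ)) (hq : Continuous q) :
    ∃ (M : ℕ) (q' : Seminorm ℂ 𝓢(Rd d, ℂ)), Continuous q' ∧
      ∀ y h, q (translation y h) ≤ (1 + ‖y‖) ^ M * q' h := by
  obtain ⟨s, C, -, hC⟩ := Seminorm.bound_of_continuous (schwartz_withSeminorms ℂ (Rd d) ℂ) q hq
  set K := s.sup Prod.fst
  set N := s.sup Prod.snd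
  refine ⟨K, (C * 2 ^ K) • (Finset.Iic (K, N)).sup (schwartzSeminormFamily ℂ (Rd d) ℂ), ?_,
    fun y h ↦ ?_⟩
  · rw [FunLike.coe_smul]
    exact (continuous_finset_sup_seminorm _).const_smul (C * 2 ^ K)
  rw [smul_apply, NNReal.smul_def, smul_eq_mul]
  push_cast
  have h1 : q (translation y h) ≤ C * s.sup (schwartzSeminormFamily ℂ (Rd d) ℂ) (translation y h) :=
    hC _
  have h2 : s.sup (schwartzSeminormFamily ℂ (Rd d) ℂ) (translation y h) ≤
      (1 + ‖y‖) ^ K * (2 ^ K * (Finset.Iic (K, N)).sup (schwartzSeminormFamily ℂ (Rd d) ℂ) h) := by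
    refine Seminorm.finset_sup_apply_le (by positivity) fun i hi ↦ ?_
    refine seminorm_le_bound ℂ i.1 i.2 _ (by positivity) fun x ↦ ?_
    rw [iteratedFDeriv_translation]
    have hK : i.1 ≤ K := Finset.le_sup (f := Prod.fst) hi
    refine (pow_norm_mul_le_of_norm_sub_le (R := ‖y‖)
      (Finset.le_sup (f := Prod.snd) hi) hK h (by simp)).trans ?_
    gcongr
    linarith [norm_nonneg y]
  calc _ ≤ _ := h1
    _ ≤ C * _ := mul_le_mul_of_nonneg_left h2 C.2
    _ = _ := by ring

/-- Mean value inequality in a ball about x containing x - y and x - y₀, with the weight ‖x‖^k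
frozen. It costs one more derivative. -/
lemma seminorm_translation_sub_le (k n : ℕ) (h : 𝓢(Rd d, ℂ)) (y y₀ : Rd d) :
    SchwartzMap.seminorm ℂ k n (translation y h - translation y₀ h) ≤
      (1 + max ‖y‖ ‖y₀‖) ^ k * (2 ^ k * (Finset.Iic (k, n + 1)).sup (schwartzSeminormFamily ℂ (Rd d) ℂ) h) *
        ‖y - y₀‖ := by
  refine seminorm_le_bound ℂ k n _ (by positivity) fun x ↦ ?_
  have e : iteratedFDeriv ℝ n (⇑(translation y h - translation y₀ h)) x =
      iteratedFDeriv ℝ n h (x - y) - iteratedFDeriv ℝ n h (x - y₀) := by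
    rw [← iteratedFDeriv_translation, ← iteratedFDeriv_translation]
    exact iteratedFDeriv_sub_apply ((translation y h).smooth n).contDiffAt
      ((translation y₀ h).smooth n).contDiffAt
  have hdiff : Differentiable ℝ (iteratedFDeriv ℝ n h) :=
    (h.smooth (n + 1 : ℕ)).differentiable_iteratedFDeriv (by exact_mod_cast n.lt_succ_self)
  have hmv := (convex_closedBall x (max ‖y‖ ‖y₀‖)).norm_image_sub_le_of_norm_fderiv_le (𝕜 := ℝ)
    (f := fun z ↦ ‖x‖ ^ k • iteratedFDeriv ℝ n h z) (x := x - y₀) (y := x - y)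
    (C := (1 + max ‖y‖ ‖y₀‖) ^ k * (2 ^ k * (Finset.Iic (k, n + 1)).sup (schwartzSeminormFamily ℂ (Rd d) ℂ) h))
    (fun z _ ↦ (hdiff z).fun_const_smul _) (fun z hz ↦ ?_) (by simp) (by simp)
  · rw [e]
    rw [← smul_sub, norm_smul, norm_pow, norm_norm] at hmv
    refine hmv.trans_eq ?_
    congr 1
    rw [sub_sub_sub_cancel_left, norm_sub_rev]
  · rw [fderiv_fun_const_smul (hdiff z), norm_smul, norm_pow, norm_norm, norm_fderiv_iteratedFDeriv]
    exact pow_norm_mul_le_of_norm_sub_le le_rfl le_rfl h (by simpa [dist_eq_norm] using hz)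

lemma translation_sub (y : Rd d) (h h' : 𝓢(Rd d, ℂ)) :
    translation y (h - h') = translation y h - translation y h' :=
  map_sub (compSubConstCLM ℂ y) h h'

/-- Translation of Schwartz functions is jointly continuous. -/
lemma continuous_translation :
    Continuous fun p : Rd d × 𝓢(Rd d, ℂ) ↦ translation p.1 p.2 := by
  rw [continuous_iff_continuousAt]
  rintro ⟨y₀, h₀⟩
  rw [ContinuousAt, (schwartz_withSeminorms ℂ (Rd d) ℂ).tendsto_nhds]
  rintro ⟨k, n⟩ ε hε
  obtain ⟨M, q', hq', hle⟩ := exists_seminorm_translation_le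
    (schwartzSeminormFamily ℂ (Rd d) ℂ (k, n))
    ((schwartz_withSeminorms ℂ (Rd d) ℂ).continuous_seminorm (k, n))
  set A := 2 ^ k * (Finset.Iic (k, n + 1)).sup (schwartzSeminormFamily ℂ (Rd d) ℂ) h₀
  have hcont : Continuous fun p : Rd d × 𝓢(Rd d, ℂ) ↦
      (1 + ‖p.1‖) ^ M * q' (p.2 - h₀) + (1 + max ‖p.1‖ ‖y₀‖) ^ k * A * ‖p.1 - y₀‖ := by
    have := hq'.comp (continuous_snd.sub (continuous_const (y := h₀)) :
      Continuous fun p : Rd d × 𝓢(Rd d, ℂ) ↦ p.2 - h₀)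
    simp only [Function.comp_def] at this
    fun_prop
  have hev := hcont.tendsto (y₀, h₀)
  simp only [sub_self, norm_zero, map_zero, mul_zero, add_zero] at hev
  filter_upwards [hev.eventually_lt_const hε] with p hp
  refine lt_of_le_of_lt ?_ hp
  have e : translation p.1 p.2 - translation y₀ h₀ =
      translation p.1 (p.2 - h₀) + (translation p.1 h₀ - translation y₀ h₀) := by
    rw [translation_sub]; abel
  rw [e]
  exact (map_add_le_add _ _ _).trans (add_le_add (hle _ _) (seminorm_translation_sub_le k n h₀ _ _))

lemma character_eq_fourierChar (ξ x : Rd d) :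
    character ξ x = (Real.fourierChar (inner ℝ x ξ) : ℂ) := by
  rw [character, Real.fourierChar_apply]

lemma norm_character (ξ x : Rd d) : ‖character ξ x‖ = 1 := by
  rw [character_eq_fourierChar]; exact Circle.norm_coe _

lemma fourier_modulation (ξ : Rd d) (g : 𝓢(Rd d, ℂ)) :
    𝓕 (modulation ξ g) = translation ξ (𝓕 g) := by
  ext σ
  rw [translation_apply, fourier_coe, fourier_coe, Real.fourier_eq, Real.fourier_eq]
  refine integral_congr_ae (.of_forall fun v ↦ ?_)
  simp only [modulation_apply, character_eq_fourierChar, Circle.smul_def, smul_eq_mul, ← mul_assoc,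
    ← Circle.coe_mul, ← AddChar.map_add_eq_mul]
  congr 3
  rw [inner_sub_right]; ring

/-- Conjugation by the Fourier transform lets the translation estimates serve for modulations too.
-/
lemma modulation_eq_fourierInv (ξ : Rd d) (g : 𝓢(Rd d, ℂ)) :
    modulation ξ g = 𝓕⁻ (translation ξ (𝓕 g)) := by
  rw [← fourier_modulation, fourierInv_fourier_eq]

lemma conjugate_modulation_translation (y ξ : Rd d) (φ : 𝓢(Rd d, ℂ)) :
    conjugate (modulation ξ (translation y φ)) =
      modulation (-ξ) (translation y (conjugate φ)) := by
  ext t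
  simp only [conjugate_apply, modulation_apply, translation_apply, map_mul]
  congr 1
  rw [character_eq_fourierChar, character_eq_fourierChar, inner_neg_right, AddChar.map_neg_eq_inv,
    Circle.coe_inv_eq_conj]

lemma continuous_conjugate_modulation_translation (φ : 𝓢(Rd d, ℂ)) :
    Continuous fun p : Rd d × Rd d ↦ conjugate (modulation p.2 (translation p.1 φ)) := by
  have e (p : Rd d × Rd d) : conjugate (modulation p.2 (translation p.1 φ)) =
      fourierInvCLM ℂ 𝓢(Rd d, ℂ) (translation (-p.2) (𝓕 (translation p.1 (conjugate φ)))) := by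
    rw [conjugate_modulation_translation, modulation_eq_fourierInv]
    rfl
  simp only [e]
  have h1 : Continuous fun p : Rd d × Rd d ↦ 𝓕 (translation p.1 (conjugate φ)) :=
    (fourierTransformCLM ℂ).continuous.comp
      (continuous_translation.comp (continuous_fst.prodMk continuous_const))
  exact (fourierInvCLM ℂ 𝓢(Rd d, ℂ)).continuous.comp
    (continuous_translation.comp (continuous_snd.neg.prodMk h1))

/-- Time-frequency shifts grow at most polynomially with respect to every continuous seminorm. -/
lemma exists_seminorm_conjugate_modulation_translation_le (q : Seminorm ℂ 𝓢(Rd d, ℂ))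
    (hq : Continuous q) (φ : 𝓢(Rd d, ℂ)) :
    ∃ (M : ℕ) (C : ℝ), 0 ≤ C ∧ ∀ y ξ, q (conjugate (modulation ξ (translation y φ))) ≤
      C * ((1 + ‖y‖) * (1 + ‖ξ‖)) ^ M := by
  let Finv : 𝓢(Rd d, ℂ) →L[ℂ] 𝓢(Rd d, ℂ) := fourierInvCLM ℂ 𝓢(Rd d, ℂ)
  let F : 𝓢(Rd d, ℂ) →L[ℂ] 𝓢(Rd d, ℂ) := fourierTransformCLM ℂ
  obtain ⟨M₁, q₁, hq₁, h₁⟩ := exists_seminorm_translation_le (q.comp Finv.toLinearMap)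
    (hq.comp Finv.continuous)
  obtain ⟨M₂, q₂, hq₂, h₂⟩ := exists_seminorm_translation_le (q₁.comp F.toLinearMap)
    (hq₁.comp F.continuous)
  refine ⟨max M₁ M₂, q₂ (conjugate φ), apply_nonneg _ _, fun y ξ ↦ ?_⟩
  rw [conjugate_modulation_translation, modulation_eq_fourierInv]
  have a := h₁ (-ξ) (𝓕 (translation y (conjugate φ)))
  have b := h₂ y (conjugate φ)
  rw [norm_neg] at a
  calc _ ≤ _ := a
    _ ≤ (1 + ‖ξ‖) ^ M₁ * ((1 + ‖y‖) ^ M₂ * q₂ (conjugate φ)) := by gcongr; exact b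
    _ ≤ (1 + ‖ξ‖) ^ max M₁ M₂ * ((1 + ‖y‖) ^ max M₁ M₂ * q₂ (conjugate φ)) := by
      gcongr <;> simp
    _ = _ := by rw [mul_pow]; ring

end SchwartzMap
end

/-! ### Decay of the coefficients and the change of window formula. -/

noncomputable section

open MeasureTheory Filter Topology FourierTransform ComplexConjugate

namespace SchwartzMap

variable {d : ℕ}

lemma exists_one_add_norm_pow_mul_le (a : 𝓢(Rd d, ℂ)) (N : ℕ) :
    ∃ A : ℝ, 0 ≤ A ∧ ∀ z, (1 + ‖z‖) ^ N * ‖a z‖ ≤ A := by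
  refine ⟨_, ?_, fun z ↦ by
    simpa using one_add_le_sup_seminorm_apply (𝕜 := ℂ) (m := (N, 0)) le_rfl le_rfl a z⟩
  positivity

lemma integrable_one_add_norm_inv_pow : Integrable fun z : Rd d ↦ ((1 + ‖z‖) ^ (d + 1))⁻¹ := by
  have h := integrable_one_add_norm (E := Rd d) (μ := volume) (r := (d + 1 : ℕ)) (by simp)
  refine h.congr (.of_forall fun z ↦ ?_)
  simp only
  rw [Real.rpow_neg (by positivity), Real.rpow_natCast]

lemma one_add_norm_add_le {E : Type*} [SeminormedAddCommGroup E] (a b : E) :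
    1 + ‖a + b‖ ≤ (1 + ‖a‖) * (1 + ‖b‖) := by
  nlinarith [norm_add_le a b, mul_nonneg (norm_nonneg a) (norm_nonneg b)]

/-- The overlap of two translated Schwartz functions decays rapidly. -/
lemma exists_overlap_le (a b : 𝓢(Rd d, ℂ)) (N : ℕ) :
    ∃ C : ℝ, 0 ≤ C ∧ ∀ x y, (1 + ‖x - y‖) ^ N * ∫ s, ‖a (s - x)‖ * ‖b (s - y)‖ ≤ C := by
  obtain ⟨A, hA, ha⟩ := exists_one_add_norm_pow_mul_le a (N + (d + 1))
  obtain ⟨B, hB, hb⟩ := exists_one_add_norm_pow_mul_le b N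
  refine ⟨A * B * ∫ z : Rd d, ((1 + ‖z‖) ^ (d + 1))⁻¹, by positivity, fun x y ↦ ?_⟩
  -- The weight splits between the two factors; the d + 1 spare powers on a make the bound
  -- integrable in s.
  have hpt (s : Rd d) : (1 + ‖x - y‖) ^ N * (‖a (s - x)‖ * ‖b (s - y)‖) ≤
      A * B * ((1 + ‖s - x‖) ^ (d + 1))⁻¹ := by
    have h1 : 1 + ‖x - y‖ ≤ (1 + ‖s - x‖) * (1 + ‖s - y‖) := by
      have := one_add_norm_add_le (x - s) (s - y)
      rwa [sub_add_sub_cancel, norm_sub_rev x s] at this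
    have h2 : (1 + ‖s - x‖) ^ N * ‖a (s - x)‖ ≤ A * ((1 + ‖s - x‖) ^ (d + 1))⁻¹ := by
      rw [le_mul_inv_iff₀ (by positivity), mul_right_comm, ← pow_add]
      exact ha _
    calc _ ≤ ((1 + ‖s - x‖) * (1 + ‖s - y‖)) ^ N * (‖a (s - x)‖ * ‖b (s - y)‖) := by gcongr
      _ = ((1 + ‖s - x‖) ^ N * ‖a (s - x)‖) * ((1 + ‖s - y‖) ^ N * ‖b (s - y)‖) := by
        rw [mul_pow]; ring
      _ ≤ (A * ((1 + ‖s - x‖) ^ (d + 1))⁻¹) * B := by gcongr; exact hb _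
      _ = _ := by ring
  rw [← integral_const_mul, ← integral_const_mul,
    ← integral_sub_right_eq_self (fun z : Rd d ↦ A * B * ((1 + ‖z‖) ^ (d + 1))⁻¹) x]
  exact integral_mono_of_nonneg (.of_forall fun s ↦ by positivity)
    ((integrable_one_add_norm_inv_pow.const_mul _).comp_sub_right x) (.of_forall hpt)

lemma norm_conjugate_modulation_translation (x η : Rd d) (φ : 𝓢(Rd d, ℂ)) (t : Rd d) :
    ‖conjugate (modulation η (translation x φ)) t‖ = ‖φ (t - x)‖ := by
  rw [conjugate_apply, modulation_apply, translation_apply, RCLike.norm_conj, norm_mul,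
    norm_character, one_mul]

lemma norm_fourier_translation (x : Rd d) (h : 𝓢(Rd d, ℂ)) (σ : Rd d) :
    ‖𝓕 (translation x h) σ‖ = ‖𝓕 h σ‖ := by
  have e : 𝓕 (translation x h) σ = (Real.fourierChar (-inner ℝ x σ) : ℂ) * 𝓕 h σ := by
    rw [fourier_coe, fourier_coe, Real.fourier_eq, Real.fourier_eq, ← integral_const_mul,
      ← integral_sub_right_eq_self (fun v ↦ (Real.fourierChar (-inner ℝ x σ) : ℂ) *
        Real.fourierChar (-inner ℝ v σ) • h v) x]
    refine integral_congr_ae (.of_forall fun v ↦ ?_)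
    simp only [translation_apply, Circle.smul_def, smul_eq_mul, ← mul_assoc,
      ← Circle.coe_mul, ← AddChar.map_add_eq_mul]
    congr 3
    rw [inner_sub_left]; ring
  rw [e, norm_mul, Circle.norm_coe, one_mul]

lemma norm_fourier_conjugate_modulation_translation (x η : Rd d) (φ : 𝓢(Rd d, ℂ)) (σ : Rd d) :
    ‖𝓕 (conjugate (modulation η (translation x φ))) σ‖ = ‖𝓕 (conjugate φ) (σ - -η)‖ := by
  rw [conjugate_modulation_translation, fourier_modulation, translation_apply,
    norm_fourier_translation]

/-- The coefficient `∫ g conj(h_{y,ξ})`, where `h_{y,ξ} = conj (M_ξ T_y φ)`. -/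
def stftCoeff (φ g : 𝓢(Rd d, ℂ)) (y ξ : Rd d) : ℂ :=
  ∫ t, conj (conjugate (modulation ξ (translation y φ)) t) * g t

lemma continuous_stftCoeff (φ g : 𝓢(Rd d, ℂ)) :
    Continuous fun p : Rd d × Rd d ↦ stftCoeff φ g p.1 p.2 := by
  have e (p : Rd d × Rd d) : stftCoeff φ g p.1 p.2 = conj (integralCLM ℂ volume
      (smulLeftCLM ℂ (conjugate g) (conjugate (modulation p.2 (translation p.1 φ))))) := by
    rw [integralCLM_apply, ← integral_conj, stftCoeff]
    refine integral_congr_ae (.of_forall fun t ↦ ?_)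
    simp only
    rw [smulLeftCLM_apply_apply (conjugate g).hasTemperateGrowth, smul_eq_mul, map_mul,
      conjugate_apply g, Complex.conj_conj, mul_comm]
  simp only [e]
  exact Complex.continuous_conj.comp ((integralCLM ℂ volume).continuous.comp
    ((smulLeftCLM ℂ (conjugate g)).continuous.comp
      (continuous_conjugate_modulation_translation φ)))

/-- Estimating the integral directly gives decay in x - y; estimating it after Parseval gives decay
in η - ξ. Taking the power 2N in each and using ab ≤ a² + b² yields joint decay. -/
lemma exists_stftCoeff_le (φ ψ : 𝓢(Rd d, ℂ)) (N : ℕ) :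
    ∃ C : ℝ, 0 ≤ C ∧ ∀ x η y ξ, ((1 + ‖x - y‖) * (1 + ‖η - ξ‖)) ^ N *
      ‖stftCoeff φ (conjugate (modulation η (translation x ψ))) y ξ‖ ≤ C := by
  obtain ⟨C₁, hC₁, h₁⟩ := exists_overlap_le φ ψ (2 * N)
  obtain ⟨C₂, hC₂, h₂⟩ := exists_overlap_le (𝓕 (conjugate φ)) (𝓕 (conjugate ψ)) (2 * N)
  refine ⟨C₁ + C₂, by positivity, fun x η y ξ ↦ ?_⟩
  set g := conjugate (modulation η (translation x ψ)) with hg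
  have b₁ : ‖stftCoeff φ g y ξ‖ ≤ ∫ s, ‖φ (s - y)‖ * ‖ψ (s - x)‖ := by
    refine (norm_integral_le_integral_norm _).trans_eq (integral_congr_ae (.of_forall fun s ↦ ?_))
    simp only [norm_mul, RCLike.norm_conj, hg, norm_conjugate_modulation_translation]
  have b₂ : ‖stftCoeff φ g y ξ‖ ≤
      ∫ s, ‖(𝓕 (conjugate φ) : 𝓢(Rd d, ℂ)) (s - -ξ)‖ *
        ‖(𝓕 (conjugate ψ) : 𝓢(Rd d, ℂ)) (s - -η)‖ := by
    have hP : stftCoeff φ g y ξ =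
        ∫ σ, inner ℂ ((𝓕 (conjugate (modulation ξ (translation y φ))) : 𝓢(Rd d, ℂ)) σ)
          ((𝓕 g : 𝓢(Rd d, ℂ)) σ) := by
      refine Eq.trans (integral_congr_ae (.of_forall fun t ↦ ?_))
        (integral_sesq_fourier_fourier (conjugate (modulation ξ (translation y φ))) g
          (innerSL ℂ)).symm
      simp [RCLike.inner_apply, mul_comm]
    rw [hP]
    refine (norm_integral_le_integral_norm _).trans (integral_mono_of_nonneg
      (.of_forall fun _ ↦ norm_nonneg _) ?_ (.of_forall fun σ ↦ ?_))
    · have hI := (smulLeftCLM ℂ (translation (-ξ) (𝓕 (conjugate φ)))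
        (translation (-η) (𝓕 (conjugate ψ)))).integrable (μ := volume) |>.norm
      refine hI.congr (.of_forall fun σ ↦ ?_)
      simp only
      rw [smulLeftCLM_apply_apply (hasTemperateGrowth _), norm_smul, translation_apply,
        translation_apply]
    · refine (norm_inner_le_norm _ _).trans_eq ?_
      rw [hg, norm_fourier_conjugate_modulation_translation,
        norm_fourier_conjugate_modulation_translation]
  have k₁ := (mul_le_mul_of_nonneg_left b₁ (by positivity)).trans (h₁ y x)
  have k₂ := (mul_le_mul_of_nonneg_left b₂ (by positivity)).trans (h₂ (-ξ) (-η))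
  rw [norm_sub_rev y x] at k₁
  rw [neg_sub_neg] at k₂
  have huv : ((1 + ‖x - y‖) * (1 + ‖η - ξ‖)) ^ N ≤
      (1 + ‖x - y‖) ^ (2 * N) + (1 + ‖η - ξ‖) ^ (2 * N) := by
    rw [mul_pow, pow_mul', pow_mul']
    nlinarith [sq_nonneg ((1 + ‖x - y‖) ^ N - (1 + ‖η - ξ‖) ^ N),
      sq_nonneg ((1 + ‖x - y‖) ^ N), sq_nonneg ((1 + ‖η - ξ‖) ^ N)]
  calc _ ≤ ((1 + ‖x - y‖) ^ (2 * N) + (1 + ‖η - ξ‖) ^ (2 * N)) * ‖stftCoeff φ g y ξ‖ := by gcongr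
    _ ≤ _ := by rw [add_mul]; exact add_le_add k₁ k₂

instance isAddRightInvariant_volume_prod :
    (volume : Measure (Rd d × Rd d)).IsAddRightInvariant := by
  rw [Measure.volume_eq_prod]
  infer_instance

lemma integrable_weight_inv_pow : Integrable fun p : Rd d × Rd d ↦
    (((1 + ‖p.1‖) * (1 + ‖p.2‖)) ^ (d + 1))⁻¹ := by
  refine (integrable_one_add_norm_inv_pow (d := d).mul_prod
    (integrable_one_add_norm_inv_pow (d := d))).congr (.of_forall fun p ↦ ?_)
  simp only [mul_pow, mul_inv]

lemma weight_le_mul (x η y ξ : Rd d) : (1 + ‖y‖) * (1 + ‖ξ‖) ≤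
    ((1 + ‖x‖) * (1 + ‖η‖)) * ((1 + ‖x - y‖) * (1 + ‖η - ξ‖)) := by
  have h1 := one_add_norm_add_le x (y - x)
  have h2 := one_add_norm_add_le η (ξ - η)
  rw [add_sub_cancel, norm_sub_rev] at h1 h2
  calc _ ≤ ((1 + ‖x‖) * (1 + ‖x - y‖)) * ((1 + ‖η‖) * (1 + ‖η - ξ‖)) := by gcongr
    _ = _ := by ring

/-- The coefficients times a polynomially bounded function are dominated by an integrable one. -/
lemma exists_stftCoeff_mul_le (φ ψ : 𝓢(Rd d, ℂ)) (L : ℕ) :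
    ∃ C : ℝ, 0 ≤ C ∧ ∀ x η y ξ, ((1 + ‖x - y‖) * (1 + ‖η - ξ‖)) ^ L *
      ‖stftCoeff φ (conjugate (modulation η (translation x ψ))) y ξ‖ ≤
        C * (((1 + ‖x - y‖) * (1 + ‖η - ξ‖)) ^ (d + 1))⁻¹ := by
  obtain ⟨C, hC, h⟩ := exists_stftCoeff_le φ ψ (L + (d + 1))
  refine ⟨C, hC, fun x η y ξ ↦ ?_⟩
  rw [le_mul_inv_iff₀ (by positivity), mul_right_comm, ← pow_add]
  exact h _ _ _ _

lemma integrable_seminorm_stftCoeff_smul (φ ψ : 𝓢(Rd d, ℂ)) (x η : Rd d)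
    (q : Seminorm ℂ 𝓢(Rd d, ℂ)) (hq : Continuous q) :
    Integrable fun p : Rd d × Rd d ↦
      q (stftCoeff φ (conjugate (modulation η (translation x ψ))) p.1 p.2 •
        conjugate (modulation p.2 (translation p.1 φ))) := by
  obtain ⟨M, C, hC, hM⟩ := exists_seminorm_conjugate_modulation_translation_le q hq φ
  obtain ⟨A, hA, hc⟩ := exists_stftCoeff_mul_le φ ψ M
  have hI := ((integrable_weight_inv_pow (d := d)).comp_sub_right (x, η)).const_mul
    (C * ((1 + ‖x‖) * (1 + ‖η‖)) ^ M * A)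
  refine hI.mono' ?_ (.of_forall fun p ↦ ?_)
  · exact (hq.comp ((continuous_stftCoeff _ _).smul
      (continuous_conjugate_modulation_translation φ))).aestronglyMeasurable
  · rw [Real.norm_of_nonneg (apply_nonneg _ _), map_smul_eq_mul]
    set c := ‖stftCoeff φ (conjugate (modulation η (translation x ψ))) p.1 p.2‖
    calc _ ≤ c * (C * ((1 + ‖p.1‖) * (1 + ‖p.2‖)) ^ M) := by gcongr; exact hM _ _
      _ ≤ c * (C * (((1 + ‖x‖) * (1 + ‖η‖)) *
          ((1 + ‖x - p.1‖) * (1 + ‖η - p.2‖))) ^ M) := by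
        refine mul_le_mul_of_nonneg_left (mul_le_mul_of_nonneg_left ?_ hC) (norm_nonneg _)
        exact pow_le_pow_left₀ (by positivity) (weight_le_mul _ _ _ _) M
      _ = C * ((1 + ‖x‖) * (1 + ‖η‖)) ^ M * (((1 + ‖x - p.1‖) * (1 + ‖η - p.2‖)) ^ M * c) := by
        rw [mul_pow _ (_ * _ : ℝ)]; ring
      _ ≤ C * ((1 + ‖x‖) * (1 + ‖η‖)) ^ M *
          (A * (((1 + ‖x - p.1‖) * (1 + ‖η - p.2‖)) ^ (d + 1))⁻¹) := by
        exact mul_le_mul_of_nonneg_left (hc _ _ _ _) (by positivity)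
      _ = _ := by simp only [Prod.fst_sub, Prod.snd_sub, norm_sub_rev x, norm_sub_rev η]; ring

/-- Inversion formula for the short-time Fourier transform, in iterated form. -/
lemma integral_stftCoeff_mul (φ g : 𝓢(Rd d, ℂ)) (y t : Rd d) :
    ∫ ξ, stftCoeff φ g y ξ * conjugate (modulation ξ (translation y φ)) t =
      g t * ((‖φ (t - y)‖ ^ 2 : ℝ) : ℂ) := by
  -- For fixed y the coefficient is the inverse Fourier transform of h = φ(· - y) g, so integrating
  -- over ξ is Fourier inversion for h.
  set h : 𝓢(Rd d, ℂ) := smulLeftCLM ℂ (translation y φ) g with hh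
  have happ (s : Rd d) : h s = φ (s - y) * g s := by
    rw [hh, smulLeftCLM_apply_apply (translation y φ).hasTemperateGrowth, smul_eq_mul,
      translation_apply]
  have hc (ξ : Rd d) : stftCoeff φ g y ξ = 𝓕⁻ h ξ := by
    rw [fourierInv_coe, Real.fourierInv_eq, stftCoeff]
    refine integral_congr_ae (.of_forall fun s ↦ ?_)
    simp only [happ, conjugate_apply, Complex.conj_conj, modulation_apply, translation_apply,
      character_eq_fourierChar, Circle.smul_def, smul_eq_mul]
    ring
  have hinv : 𝓕 (𝓕⁻ h) t = h t := by rw [fourier_fourierInv_eq]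
  rw [fourier_coe, Real.fourier_eq] at hinv
  calc _ = ∫ ξ, (Real.fourierChar (-inner ℝ ξ t) • (𝓕⁻ h) ξ) * conj (φ (t - y)) := by
        refine integral_congr_ae (.of_forall fun ξ ↦ ?_)
        simp only [hc, conjugate_apply, modulation_apply, translation_apply, map_mul,
          character_eq_fourierChar, Circle.smul_def, smul_eq_mul, AddChar.map_neg_eq_inv,
          Circle.coe_inv_eq_conj, real_inner_comm t ξ]
        ring
    _ = _ := by
      rw [integral_mul_const, hinv, happ, mul_right_comm, Complex.mul_conj, Complex.normSq_eq_norm_sq]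
      ring

/-- Fubini: the ξ-integral gives g(t)|φ(t - y)|², and the y-integral of the last factor is ‖φ‖₂². -/
lemma integral_stftCoeff_smul (φ ψ : 𝓢(Rd d, ℂ)) (x η t : Rd d) :
    ∫ p : Rd d × Rd d, (stftCoeff φ (conjugate (modulation η (translation x ψ))) p.1 p.2 •
        conjugate (modulation p.2 (translation p.1 φ))) t =
      (((∫ s, ‖φ s‖ ^ 2 : ℝ) : ℂ) • conjugate (modulation η (translation x ψ))) t := by
  set g := conjugate (modulation η (translation x ψ))
  have hI : Integrable (fun p : Rd d × Rd d ↦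
      stftCoeff φ g p.1 p.2 * conjugate (modulation p.2 (translation p.1 φ)) t) := by
    refine (integrable_seminorm_stftCoeff_smul φ ψ x η
      (schwartzSeminormFamily ℂ (Rd d) ℂ (0, 0))
      ((schwartz_withSeminorms ℂ (Rd d) ℂ).continuous_seminorm (0, 0))).mono' ?_
      (.of_forall fun p ↦ norm_le_seminorm ℂ
        (stftCoeff φ g p.1 p.2 • conjugate (modulation p.2 (translation p.1 φ))) t)
    exact ((continuous_stftCoeff φ g).mul (((TemperedDistribution.delta t).continuous).comp
      (continuous_conjugate_modulation_translation φ))).aestronglyMeasurable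
  simp only [smul_apply, smul_eq_mul]
  rw [Measure.volume_eq_prod] at hI ⊢
  rw [integral_prod _ hI]
  simp only [integral_stftCoeff_mul]
  rw [integral_const_mul, integral_complex_ofReal,
    integral_sub_left_eq_self (fun s ↦ ‖φ s‖ ^ 2) volume t, mul_comm]

/-- The short-time Fourier transform with window `ψ` in terms of the one with window `φ`. -/
theorem stft_change_window (φ ψ : 𝓢(Rd d, ℂ)) (f : 𝓢'(Rd d, ℂ)) (x η : Rd d) :
    ((∫ s, ‖φ s‖ ^ 2 : ℝ) : ℂ) * stft ψ f x η = ∫ p : Rd d × Rd d,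
      stftCoeff φ (conjugate (modulation η (translation x ψ))) p.1 p.2 * stft φ f p.1 p.2 := by
  let f' : 𝓢(Rd d, ℂ) →L[ℂ] ℂ := f
  have h := map_eq_integral (μ := (volume : Measure (Rd d × Rd d)))
    ((continuous_stftCoeff φ (conjugate (modulation η (translation x ψ)))).smul
      (continuous_conjugate_modulation_translation φ))
    (fun k n ↦ integrable_seminorm_stftCoeff_smul φ ψ x η
      (schwartzSeminormFamily ℂ (Rd d) ℂ (k, n))
      ((schwartz_withSeminorms ℂ (Rd d) ℂ).continuous_seminorm (k, n)))
    (integral_stftCoeff_smul φ ψ x η) f'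
  simp only [Pi.smul_apply', map_smul, smul_eq_mul] at h
  exact h

lemma exists_stft_le (φ : 𝓢(Rd d, ℂ)) (f : 𝓢'(Rd d, ℂ)) :
    ∃ (M : ℕ) (C : ℝ), 0 ≤ C ∧ ∀ y ξ, ‖stft φ f y ξ‖ ≤ C * ((1 + ‖y‖) * (1 + ‖ξ‖)) ^ M := by
  let f' : 𝓢(Rd d, ℂ) →L[ℂ] ℂ := f
  exact exists_seminorm_conjugate_modulation_translation_le
    ((normSeminorm ℂ ℂ).comp f'.toLinearMap) (continuous_norm.comp f'.continuous) φ

lemma integral_norm_sq_pos {φ : 𝓢(Rd d, ℂ)} (hφ : φ ≠ 0) : 0 < ∫ s, ‖φ s‖ ^ 2 := by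
  obtain ⟨s, hs⟩ : ∃ s, φ s ≠ 0 := by
    by_contra! h
    exact hφ (SchwartzMap.ext h)
  have hint : Integrable fun s ↦ ‖φ s‖ ^ 2 :=
    (memLp_two_iff_integrable_sq_norm φ.continuous.aestronglyMeasurable).1 (φ.memLp 2)
  rw [integral_pos_iff_support_of_nonneg (fun s ↦ sq_nonneg ‖φ s‖) hint]
  exact (φ.continuous.norm.pow 2).isOpen_support.measure_pos volume ⟨s, by simpa using hs⟩

end SchwartzMap
end

/-! ### Cone geometry and the conclusion. -/

noncomputable section

open MeasureTheory SchwartzMap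

variable {d : ℕ}

lemma bracket_le_weight (x η : Rd d) : bracket x η ≤ (1 + ‖x‖) * (1 + ‖η‖) := by
  refine Real.sqrt_le_iff.2 ⟨by positivity, ?_⟩
  nlinarith [norm_nonneg x, norm_nonneg η, mul_nonneg (norm_nonneg x) (norm_nonneg η),
    mul_nonneg (mul_nonneg (norm_nonneg x) (norm_nonneg η)) (norm_nonneg x),
    mul_nonneg (mul_nonneg (norm_nonneg x) (norm_nonneg η)) (norm_nonneg η),
    sq_nonneg (‖x‖ * ‖η‖)]

/-- With `bracket_le_weight`, this lets the product weight, convenient for Fubini, replace the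
bracket: only the exponents change. -/
lemma weight_le_bracket_sq (x η : Rd d) : (1 + ‖x‖) * (1 + ‖η‖) ≤ 2 * bracket x η ^ 2 := by
  rw [bracket, Real.sq_sqrt (by positivity)]
  nlinarith [sq_nonneg (‖x‖ - 1), sq_nonneg (‖η‖ - 1), sq_nonneg (‖x‖ - ‖η‖)]

/-- If `(x, η)` lies in the cone of slope `B'` and `(y, ξ)` outside the cone of slope `B < B'`, then
`(x, η)` is controlled by the difference. -/
lemma exists_weight_le_of_cone {B B' : ℝ} (hB : 0 < B) (hB' : B < B') :
    ∃ K : ℝ, 0 ≤ K ∧ ∀ x η y ξ : Rd d, B' * ‖x‖ < ‖η‖ → ‖ξ‖ ≤ B * ‖y‖ →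
      (1 + ‖x‖) * (1 + ‖η‖) ≤ K * ((1 + ‖x - y‖) * (1 + ‖η - ξ‖)) ^ 2 := by
  have hB'0 : 0 < B' := hB.trans hB'
  have hsub : 0 < B' - B := sub_pos.2 hB'
  set A := B' * (1 + B) / (B' - B) with hA
  have hA0 : 0 ≤ A := by positivity
  refine ⟨(1 + A / B') * (1 + A), by positivity, fun x η y ξ hx hξ ↦ ?_⟩
  set W := (1 + ‖x - y‖) * (1 + ‖η - ξ‖) with hW
  have hW1 : 1 + ‖x - y‖ + ‖η - ξ‖ ≤ W := by
    nlinarith [mul_nonneg (norm_nonneg (x - y)) (norm_nonneg (η - ξ))]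
  have h1 : ‖η‖ ≤ ‖η - ξ‖ + ‖ξ‖ := by simpa using norm_add_le (η - ξ) ξ
  have h2 : ‖y‖ ≤ ‖x - y‖ + ‖x‖ := by
    have := norm_sub_le x (x - y)
    rw [sub_sub_cancel] at this
    linarith
  have h3 : ‖η‖ ≤ ‖η - ξ‖ + B * (‖x - y‖ + ‖x‖) :=
    h1.trans (by linarith [mul_le_mul_of_nonneg_left h2 hB.le])
  -- Multiply `h3` by B' and use B'‖x‖ < ‖η‖: the term B B'‖x‖ is absorbed on the left because B <
  -- B'.
  have h4 : (B' - B) * ‖η‖ ≤ B' * (1 + B) * (‖x - y‖ + ‖η - ξ‖) := by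
    have h5 := mul_le_mul_of_nonneg_left h3 hB'0.le
    have h6 := mul_le_mul_of_nonneg_left hx.le hB.le
    have h7 : 0 ≤ B' * ‖x - y‖ := by positivity
    have h8 : 0 ≤ B' * B * ‖η - ξ‖ := by positivity
    nlinarith
  have hη : ‖η‖ ≤ A * W := by
    have h5 : ‖η‖ ≤ A * (‖x - y‖ + ‖η - ξ‖) := by
      rw [hA, div_mul_eq_mul_div, le_div_iff₀ hsub]
      linarith
    exact h5.trans (mul_le_mul_of_nonneg_left (by linarith) hA0)
  have hx' : ‖x‖ ≤ A / B' * W := by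
    rw [div_mul_eq_mul_div, le_div_iff₀ hB'0]
    linarith
  have hW0 : 1 ≤ W := by linarith [norm_nonneg (x - y), norm_nonneg (η - ξ)]
  calc (1 + ‖x‖) * (1 + ‖η‖) ≤ ((1 + A / B') * W) * ((1 + A) * W) := by
        gcongr
        · linarith
        · linarith
    _ = _ := by ring

lemma RapidDecayInCone.exists_weight_le {φ : 𝓢(Rd d, ℂ)} {B : ℝ} {f : 𝓢'(Rd d, ℂ)}
    (h : RapidDecayInCone φ B f) {n : ℕ} (hn : 0 < n) :
    ∃ C : ℝ, 0 ≤ C ∧ ∀ y ξ : Rd d, B * ‖y‖ < ‖ξ‖ →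
      ((1 + ‖y‖) * (1 + ‖ξ‖)) ^ n * ‖stft φ f y ξ‖ ≤ C := by
  obtain ⟨C, hC⟩ := h (2 * n) (by omega)
  refine ⟨2 ^ n * |C|, by positivity, fun y ξ hy ↦ ?_⟩
  calc _ ≤ (2 * bracket y ξ ^ 2) ^ n * ‖stft φ f y ξ‖ := by
        exact mul_le_mul_of_nonneg_right
          (pow_le_pow_left₀ (by positivity) (weight_le_bracket_sq y ξ) n) (norm_nonneg _)
    _ = 2 ^ n * (bracket y ξ ^ (2 * n) * ‖stft φ f y ξ‖) := by rw [mul_pow, ← pow_mul, mul_assoc]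
    _ ≤ 2 ^ n * |C| := by gcongr; exact (hC y ξ hy).trans (le_abs_self C)

/-- Decay in a cone as a weighted estimate at all points of the time-frequency plane. -/
lemma RapidDecayInCone.exists_le_weight_sub {φ : 𝓢(Rd d, ℂ)} {B B' : ℝ} {f : 𝓢'(Rd d, ℂ)}
    (h : RapidDecayInCone φ B f) (hB : 0 < B) (hB' : B < B') {n : ℕ} (hn : 0 < n) :
    ∃ (L : ℕ) (C : ℝ), 0 ≤ C ∧ ∀ x η y ξ : Rd d, B' * ‖x‖ < ‖η‖ →
      ((1 + ‖x‖) * (1 + ‖η‖)) ^ n * ‖stft φ f y ξ‖ ≤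
        C * ((1 + ‖x - y‖) * (1 + ‖η - ξ‖)) ^ L := by
  obtain ⟨C₁, hC₁, h₁⟩ := h.exists_weight_le hn
  obtain ⟨M, C₂, hC₂, h₂⟩ := exists_stft_le φ f
  obtain ⟨K, hK, h₃⟩ := exists_weight_le_of_cone (d := d) hB hB'
  -- Inside the cone of slope B the power n of W suffices, outside it 2(n + M) + M; since W ≥ 1 the
  -- sum serves both.
  refine ⟨n + (2 * (n + M) + M), C₁ + C₂ * K ^ (n + M), by positivity, fun x η y ξ hx ↦ ?_⟩
  set W := (1 + ‖x - y‖) * (1 + ‖η - ξ‖) with hW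
  set w := (1 + ‖x‖) * (1 + ‖η‖) with hw
  have hW1 : 1 ≤ W := one_le_mul_of_one_le_of_one_le (by simp) (by simp)
  rw [add_mul]
  rcases lt_or_ge (B * ‖y‖) ‖ξ‖ with hy | hy
  · have hwle : w ≤ ((1 + ‖y‖) * (1 + ‖ξ‖)) * W := by
      have := weight_le_mul y ξ x η
      rwa [norm_sub_rev y, norm_sub_rev ξ] at this
    refine le_add_of_le_of_nonneg ?_ (by positivity)
    calc _ ≤ (((1 + ‖y‖) * (1 + ‖ξ‖)) * W) ^ n * ‖stft φ f y ξ‖ := by gcongr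
      _ = (((1 + ‖y‖) * (1 + ‖ξ‖)) ^ n * ‖stft φ f y ξ‖) * W ^ n := by
        rw [mul_pow _ W]; ring
      _ ≤ C₁ * W ^ (n + (2 * (n + M) + M)) := by
        exact mul_le_mul (h₁ y ξ hy) (pow_le_pow_right₀ hW1 (by omega)) (by positivity) hC₁
  · refine le_add_of_nonneg_of_le (by positivity) ?_
    calc _ ≤ w ^ n * (C₂ * (w * W) ^ M) := by
          gcongr
          refine (h₂ y ξ).trans (mul_le_mul_of_nonneg_left ?_ hC₂)
          exact pow_le_pow_left₀ (by positivity) (weight_le_mul x η y ξ) M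
      _ = C₂ * w ^ (n + M) * W ^ M := by rw [mul_pow w W, pow_add]; ring
      _ ≤ C₂ * (K * W ^ 2) ^ (n + M) * W ^ M := by gcongr; exact h₃ x η y ξ hx hy
      _ = C₂ * K ^ (n + M) * W ^ (2 * (n + M) + M) := by
        rw [mul_pow, ← pow_mul, pow_add _ (2 * (n + M))]; ring
      _ ≤ C₂ * K ^ (n + M) * W ^ (n + (2 * (n + M) + M)) := by
        exact mul_le_mul_of_nonneg_left (pow_le_pow_right₀ hW1 (by omega)) (by positivity)

/-- Changing the window preserves rapid decay in a cone, at the cost of shrinking the cone. -/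
theorem RapidDecayInCone.change_window {φ ψ : 𝓢(Rd d, ℂ)} (hφ : φ ≠ 0) {B B' : ℝ}
    {f : 𝓢'(Rd d, ℂ)} (h : RapidDecayInCone φ B f) (hB : 0 < B) (hB' : B < B') :
    RapidDecayInCone ψ B' f := by
  intro n hn
  obtain ⟨L, C₁, hC₁, h₁⟩ := h.exists_le_weight_sub hB hB' hn
  -- The coefficient absorbs W^L and still leaves W^(-(d+1)), whose integral `J` does not depend on
  -- (x, η) by translation invariance.
  obtain ⟨C₂, hC₂, h₂⟩ := exists_stftCoeff_mul_le φ ψ L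
  have hI₀ := integral_norm_sq_pos hφ
  set I := ∫ s, ‖φ s‖ ^ 2
  set J := ∫ p : Rd d × Rd d, (((1 + ‖p.1‖) * (1 + ‖p.2‖)) ^ (d + 1))⁻¹ with hJ
  refine ⟨C₁ * C₂ * J / I, fun x η hx ↦ ?_⟩
  rw [le_div_iff₀ hI₀]
  set w := (1 + ‖x‖) * (1 + ‖η‖) with hw
  set c : Rd d × Rd d → ℂ := fun p ↦
    stftCoeff φ (conjugate (modulation η (translation x ψ))) p.1 p.2 with hc
  have hpt (p : Rd d × Rd d) : ‖(w : ℂ) ^ n * (c p * stft φ f p.1 p.2)‖ ≤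
      C₁ * C₂ * (((1 + ‖(p - (x, η)).1‖) * (1 + ‖(p - (x, η)).2‖)) ^ (d + 1))⁻¹ := by
    rw [Prod.fst_sub, Prod.snd_sub, norm_sub_rev p.1, norm_sub_rev p.2]
    calc _ = ‖c p‖ * (w ^ n * ‖stft φ f p.1 p.2‖) := by
          rw [norm_mul, norm_mul, norm_pow, Complex.norm_real, Real.norm_of_nonneg (by positivity)]
          ring
      _ ≤ ‖c p‖ * (C₁ * ((1 + ‖x - p.1‖) * (1 + ‖η - p.2‖)) ^ L) := by
        exact mul_le_mul_of_nonneg_left (h₁ x η p.1 p.2 hx) (norm_nonneg _)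
      _ = C₁ * (((1 + ‖x - p.1‖) * (1 + ‖η - p.2‖)) ^ L * ‖c p‖) := by ring
      _ ≤ C₁ * (C₂ * (((1 + ‖x - p.1‖) * (1 + ‖η - p.2‖)) ^ (d + 1))⁻¹) := by
        exact mul_le_mul_of_nonneg_left (h₂ x η p.1 p.2) hC₁
      _ = _ := by ring
  have hb : bracket x η ^ n ≤ w ^ n :=
    pow_le_pow_left₀ (Real.sqrt_nonneg _) (bracket_le_weight x η) n
  calc bracket x η ^ n * ‖stft ψ f x η‖ * I ≤ w ^ n * ‖stft ψ f x η‖ * I := by gcongr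
    _ = ‖(w : ℂ) ^ n * ((I : ℂ) * stft ψ f x η)‖ := by
      rw [norm_mul, norm_mul, norm_pow, Complex.norm_real, Complex.norm_real,
        Real.norm_of_nonneg hI₀.le, Real.norm_of_nonneg (by positivity)]
      ring
    _ = ‖∫ p, (w : ℂ) ^ n * (c p * stft φ f p.1 p.2)‖ := by
      rw [stft_change_window, integral_const_mul]
    _ ≤ ∫ p : Rd d × Rd d,
        C₁ * C₂ * (((1 + ‖(p - (x, η)).1‖) * (1 + ‖(p - (x, η)).2‖)) ^ (d + 1))⁻¹ :=
      norm_integral_le_of_norm_le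
        (((integrable_weight_inv_pow (d := d)).comp_sub_right (x, η)).const_mul _)
        (.of_forall hpt)
    _ = C₁ * C₂ * J := by
      rw [integral_const_mul, integral_sub_right_eq_self
        (fun p : Rd d × Rd d ↦ (((1 + ‖p.1‖) * (1 + ‖p.2‖)) ^ (d + 1))⁻¹) (x, η)]

lemma Vcon_le {φ ψ : 𝓢(Rd d, ℂ)} (hφ : φ ≠ 0) : Vcon φ ≤ Vcon ψ := by
  rintro f ⟨B, hB, h⟩
  exact ⟨B + 1, by positivity, h.change_window hφ hB (lt_add_one B)⟩

end

theorem mainTheorem9 (d : ℕ) (φ ψ : 𝓢(Rd d, ℂ)) (hφ : φ ≠ 0) (hψ : ψ ≠ 0) :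
    Vcon φ = Vcon ψ ∧
      ∀ (f : 𝓢'(Rd d, ℂ)) (B : ℝ), 0 < B → RapidDecayInCone φ B f →
        ∀ B' : ℝ, B < B' → RapidDecayInCone ψ B' f :=
  ⟨le_antisymm (Vcon_le hφ) (Vcon_le hψ),
    fun _ _ hB h _ hB' ↦ h.change_window hφ hB hB'⟩
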